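/- Let $n\ge 3$ and let $R_n$ be the linear hexagonal cylinder chain with $n$ hexagons, that is, the graph with the $4n$ vertices $p_i,u_i,q_i,v_i$ and the $5n$ edges $p_iu_i,\ u_ip_{i+1},\ q_iv_i,\ v_iq_{i+1},\ p_iq_i$ (indices modulo $n$). Let $r(a,b)$ denote the effective resistance (resistance distance) between the vertices $a$ and $b$ of $R_n$ when every edge is a unit resistor, i.e. the potential difference between $a$ and $b$ when a unit current enters at $a$ and leaves at $b$. Then for all vertices $a,b$ of $R_n$, $$r(a,b)\le r\bigl(u_1,v_{\lfloor (n+2)/2\rfloor}\bigr),$$ and for all vertices $a\neq b$ of $R_n$, $$r(a,b)\ge r(p_1,q_1).$$ -/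

import Mathlib

open Classical in
/-- `f` is an electric potential on the network obtained from `G` by replacing every edge with a
unit resistor, when a unit current enters at `a` and leaves at `b`: by the laws of Ohm and
Kirchhoff, the net current flowing out of each vertex `x` into the network,
`∑ y ~ x, (f x - f y)`, is `1` at `a`, `-1` at `b` and `0` elsewhere (identically `0` if
`a = b`). -/
def IsUnitCurrentPotential {V : Type*} [Fintype V] (G : SimpleGraph V) (a b : V) (f : V → ℝ) :
    Prop :=
  ∀ x : V, ∑ y ∈ G.neighborFinset x, (f x - f y) =
    (if x = a then 1 else 0) - (if x = b then 1 else 0)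

open Classical in
/-- The effective resistance (resistance distance) between `a` and `b` in a connected finite
graph with unit resistors on its edges: the potential difference between `a` and `b` when a unit
current enters at `a` and leaves at `b`. In a connected graph such a potential exists and the
difference does not depend on it (`exists_isUnitCurrentPotential`,
`effectiveResistance_eq`). The value `0` is a dummy, used only when there is no potential. -/
noncomputable def effectiveResistance {V : Type*} [Fintype V] (G : SimpleGraph V) (a b : V) : ℝ :=
  if h : ∃ f : V → ℝ, IsUnitCurrentPotential G a b f then h.choose a - h.choose b else 0

open Classical in
theorem isUnitCurrentPotential_iff {V : Type*} [Fintype V] (G : SimpleGraph V) (a b : V)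
    (f : V → ℝ) :
    IsUnitCurrentPotential G a b f ↔
      (G.lapMatrix ℝ).mulVec f = Pi.single a 1 - Pi.single b 1 := by
  simp only [IsUnitCurrentPotential, funext_iff, SimpleGraph.lapMatrix_mulVec_apply,
    Finset.sum_sub_distrib, Finset.sum_const, SimpleGraph.card_neighborFinset_eq_degree,
    nsmul_eq_mul, Pi.sub_apply, Pi.single_apply]

/-- In a connected graph the effective resistance can be computed from any potential. -/
theorem effectiveResistance_eq {V : Type*} [Fintype V] {G : SimpleGraph V} (hG : G.Connected)
    {a b : V} {f : V → ℝ} (hf : IsUnitCurrentPotential G a b f) :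
    effectiveResistance G a b = f a - f b := by
  classical
  have h : ∃ f : V → ℝ, IsUnitCurrentPotential G a b f := ⟨f, hf⟩
  have h1 := (isUnitCurrentPotential_iff G a b _).1 h.choose_spec
  have h2 := (isUnitCurrentPotential_iff G a b _).1 hf
  have h3 : (G.lapMatrix ℝ).mulVec (h.choose - f) = 0 := by
    rw [Matrix.mulVec_sub, h1, h2, sub_self]
  have h4 := (G.lapMatrix_mulVec_eq_zero_iff_forall_reachable).1 h3 a b (hG.preconnected a b)
  simp only [Pi.sub_apply] at h4
  rw [effectiveResistance, dif_pos h]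
  linarith

/-- In a connected graph a potential for the unit current from `a` to `b` exists. -/
theorem exists_isUnitCurrentPotential {V : Type*} [Fintype V] {G : SimpleGraph V}
    (hG : G.Connected) (a b : V) : ∃ f : V → ℝ, IsUnitCurrentPotential G a b f := by
  classical
  -- The Laplacian plus the all-ones matrix is injective, hence surjective.
  let T : (V → ℝ) →ₗ[ℝ] (V → ℝ) :=
    (G.lapMatrix ℝ + Matrix.of fun _ _ => (1 : ℝ)).mulVecLin
  have hT : ∀ f x, T f x = (G.lapMatrix ℝ).mulVec f x + ∑ y, f y := by
    intro f x
    simp [T, Matrix.mulVec, dotProduct]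
  have hsum : ∀ f : V → ℝ, ∑ x, (G.lapMatrix ℝ).mulVec f x = 0 := by
    intro f
    have h := G.lapMatrix_mulVec_const_eq_zero (R := ℝ)
    have h' : dotProduct (fun _ => (1 : ℝ)) ((G.lapMatrix ℝ).mulVec f) = 0 := by
      rw [Matrix.dotProduct_mulVec, ← Matrix.mulVec_transpose, (G.isSymm_lapMatrix (R := ℝ)).eq, h,
        zero_dotProduct]
    simpa [dotProduct] using h'
  have hcard : (Fintype.card V : ℝ) ≠ 0 := by
    have : Nonempty V := ⟨a⟩
    exact_mod_cast Fintype.card_ne_zero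
  have hTs : ∀ f, ∑ x, T f x = Fintype.card V * ∑ y, f y := by
    intro f
    simp [hT, Finset.sum_add_distrib, hsum]
  have hinj : Function.Injective T := by
    rw [← LinearMap.ker_eq_bot, LinearMap.ker_eq_bot']
    intro f hf
    have hs : ∑ y, f y = 0 := by
      have := hTs f
      rw [hf] at this
      simpa [hcard] using this.symm
    have hL : (G.lapMatrix ℝ).mulVec f = 0 := by
      funext x
      have := hT f x
      rw [hf, hs] at this
      simpa using this.symm
    have hc := (G.lapMatrix_mulVec_eq_zero_iff_forall_reachable).1 hL
    funext x
    have : ∑ y, f y = Fintype.card V * f x := by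
      rw [Finset.sum_congr rfl fun y _ => hc y x (hG.preconnected y x)]
      simp
    rw [hs] at this
    simpa [hcard] using this.symm
  obtain ⟨f, hf⟩ := (LinearMap.injective_iff_surjective.1 hinj)
    (Pi.single a 1 - Pi.single b 1)
  have hs : ∑ y, f y = 0 := by
    have := hTs f
    rw [hf] at this
    simpa [hcard, Finset.sum_sub_distrib] using this.symm
  refine ⟨f, (isUnitCurrentPotential_iff G a b f).2 ?_⟩
  funext x
  have := hT f x
  rw [hf, hs, add_zero] at this
  exact this.symm

/-- The `4n` vertices of the linear hexagonal cylinder chain with `n` hexagons (`n ≥ 1`): four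
families `p`, `u`, `q`, `v`, each indexed cyclically, modulo `n`. -/
abbrev HexVertex (n : ℕ) : Type := Fin 4 × ZMod n

namespace HexVertex

/-- The vertex `p_i`. -/
def p {n : ℕ} (i : ZMod n) : HexVertex n := (0, i)

/-- The vertex `u_i`. -/
def u {n : ℕ} (i : ZMod n) : HexVertex n := (1, i)

/-- The vertex `q_i`. -/
def q {n : ℕ} (i : ZMod n) : HexVertex n := (2, i)

/-- The vertex `v_i`. -/
def v {n : ℕ} (i : ZMod n) : HexVertex n := (3, i)

end HexVertex

/-- The linear hexagonal cylinder chain `R_n`: its edges are `p_i u_i`, `u_i p_{i+1}`, `q_i v_i`,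
`v_i q_{i+1}` and `p_i q_i`, indices modulo `n`. The hexagons are
`p_{i-1}, u_{i-1}, p_i, q_i, v_{i-1}, q_{i-1}`. -/
def hexCylinder (n : ℕ) : SimpleGraph (HexVertex n) :=
  SimpleGraph.fromRel fun x y => ∃ i : ZMod n,
    (x = HexVertex.p i ∧ y = HexVertex.u i) ∨
    (x = HexVertex.u i ∧ y = HexVertex.p (i + 1)) ∨
    (x = HexVertex.q i ∧ y = HexVertex.v i) ∨
    (x = HexVertex.v i ∧ y = HexVertex.q (i + 1)) ∨
    (x = HexVertex.p i ∧ y = HexVertex.q i)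

theorem hexCylinder_connected (n : ℕ) [NeZero n] : (hexCylinder n).Connected := by
  have hpu : ∀ i : ZMod n, (hexCylinder n).Adj (.p i) (.u i) := fun i =>
    ⟨by simp [HexVertex.p, HexVertex.u], Or.inl ⟨i, Or.inl ⟨rfl, rfl⟩⟩⟩
  have hup : ∀ i : ZMod n, (hexCylinder n).Adj (.u i) (.p (i + 1)) := fun i =>
    ⟨by simp [HexVertex.p, HexVertex.u], Or.inl ⟨i, Or.inr (Or.inl ⟨rfl, rfl⟩)⟩⟩
  have hqv : ∀ i : ZMod n, (hexCylinder n).Adj (.q i) (.v i) := fun i =>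
    ⟨by simp [HexVertex.q, HexVertex.v], Or.inl ⟨i, Or.inr (Or.inr (Or.inl ⟨rfl, rfl⟩))⟩⟩
  have hpq : ∀ i : ZMod n, (hexCylinder n).Adj (.p i) (.q i) := fun i =>
    ⟨by simp [HexVertex.p, HexVertex.q],
      Or.inl ⟨i, Or.inr (Or.inr (Or.inr (Or.inr ⟨rfl, rfl⟩)))⟩⟩
  have hp : ∀ k : ℕ, (hexCylinder n).Reachable (.p 0) (.p (k : ZMod n)) := by
    intro k
    induction k with
    | zero => simp
    | succ k ih =>
      rw [Nat.cast_succ]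
      exact ih.trans ((hpu _).reachable.trans (hup _).reachable)
  have hp' : ∀ i : ZMod n, (hexCylinder n).Reachable (.p 0) (.p i) := by
    intro i
    have := hp i.val
    rwa [ZMod.natCast_zmod_val] at this
  have hall : ∀ x : HexVertex n, (hexCylinder n).Reachable (.p 0) x := by
    rintro ⟨t, i⟩
    fin_cases t
    · exact hp' i
    · exact (hp' i).trans (hpu i).reachable
    · exact (hp' i).trans (hpq i).reachable
    · exact (hp' i).trans ((hpq i).reachable.trans (hqv i).reachable)
  exact { preconnected := fun x y => (hall x).symm.trans (hall y), nonempty := ⟨.p 0⟩ }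

/-!
The reflection that exchanges `p_i` with `q_i` and `u_i` with `v_i` splits the Laplacian of `R_n`
into a symmetric and an antisymmetric part. On symmetric functions no current flows through the
rungs `p_i q_i`, and what is left is a cycle of length `2n`. On antisymmetric functions each rung
leaks to the ground with conductance `2`, and elimination of the `u_i` leaves the recurrence
`6 A k - A (k - 1) - A (k + 1) = 2 δ` on `ZMod n`. Hence a Green function of `R_n` is
`(C ± A) / 2`, where `C` comes from the parabola `h k = -k (n - k) / n` (`parabola`), `A` is the
periodic combination of the powers of `3 - 2 √2` (`decay`), and the sign tells whether the two
vertices lie on the same side (`laplacian_green`). Resistances follow from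
`r(a, b) = G(a, a) + G(b, b) - 2 G(a, b)` (`effectiveResistance_eq_green`); for index difference `k`
they are

* `-h k + A 0 ∓ A k` between two vertices of `p` or `q`,
* `-h k + 2 A 0 ∓ 2 A k` between two vertices of `u` or `v`,
* `-(h k + h (k - 1)) / 2 + 1 / (4 n) + 3 A 0 / 2 ∓ (A k + A (k - 1)) / 2` in the mixed case,

the upper sign for vertices on the same side. The recurrence at `0` gives `A 1 = 3 A 0 - 1`, which
with `0 ≤ A 1` and `5 A 1 ≤ A 0` confines `A 0` to `[1/3, 5/14]`. These bounds decide all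
comparisons but one: among the pairs `u_i, v_j`, the growth of `k (n - k) / n` has to beat the
decrease of `2 A k` up to `k = ⌊n / 2⌋`. There the recurrence shows that the increments of `A`
shrink by a factor of at least `5` at each step (`parabola_add_decay_le`).
-/

/-! ### Functions on `ZMod n` from functions on `{0, …, n}` -/

/-- The function on `ZMod n` that reads off a function of natural numbers at the representative in
`{0, …, n - 1}`. -/
def periodize (n : ℕ) (a : ℕ → ℝ) (k : ZMod n) : ℝ := a k.val

lemma periodize_natCast {n : ℕ} [NeZero n] {a : ℕ → ℝ} (ha : a n = a 0) {j : ℕ} (hj : j ≤ n) :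
    periodize n a (j : ZMod n) = a j := by
  rcases hj.lt_or_eq with h | rfl
  · rw [periodize, ZMod.val_natCast_of_lt h]
  · simp [periodize, ha]

lemma periodize_zero {n : ℕ} [NeZero n] (a : ℕ → ℝ) : periodize n a 0 = a 0 := by
  simp [periodize]

lemma periodize_neg {n : ℕ} [NeZero n] {a : ℕ → ℝ} (ha : ∀ j ≤ n, a (n - j) = a j) (k : ZMod n) :
    periodize n a (-k) = periodize n a k := by
  have h0 : a n = a 0 := by simpa using ha 0 (Nat.zero_le _)
  have hk : k.val ≤ n := (ZMod.val_lt k).le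
  have : -k = ((n - k.val : ℕ) : ZMod n) := by
    rw [Nat.cast_sub hk]; simp
  rw [this, periodize_natCast h0 (Nat.sub_le _ _), ha _ hk, periodize]

/-- A three-term recurrence on `{1, …, n - 1}`, together with its value at the seam `0 = n`, passes
to the periodization. -/
lemma periodize_recurrence {n : ℕ} [NeZero n] {a : ℕ → ℝ} (ha : a n = a 0) {b c d : ℝ}
    (hn : 2 ≤ n) (hint : ∀ j, j + 2 ≤ n → b * a (j + 1) - a j - a (j + 2) = c)
    (hseam : b * a 0 - a (n - 1) - a 1 = c + d) (k : ZMod n) :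
    b * periodize n a k - periodize n a (k - 1) - periodize n a (k + 1) =
      c + if k = 0 then d else 0 := by
  rcases eq_or_ne k 0 with rfl | hk
  · have h1 : (0 - 1 : ZMod n) = ((n - 1 : ℕ) : ZMod n) := by
      rw [Nat.cast_sub (by omega)]; simp
    have h2 : (0 + 1 : ZMod n) = ((1 : ℕ) : ZMod n) := by simp
    rw [h1, h2, periodize_natCast ha (by omega), periodize_natCast ha (by omega), periodize_zero,
      if_pos rfl, hseam]
  · have hlt := ZMod.val_lt k
    have hv : k.val ≠ 0 := by rwa [Ne, ZMod.val_eq_zero]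
    obtain ⟨j, hj⟩ : ∃ j, k.val = j + 1 := ⟨k.val - 1, by omega⟩
    have hkj : k = ((j + 1 : ℕ) : ZMod n) := by rw [← hj, ZMod.natCast_zmod_val]
    have h1 : k - 1 = (j : ZMod n) := by rw [hkj]; push_cast; ring
    have h2 : k + 1 = ((j + 2 : ℕ) : ZMod n) := by rw [hkj]; push_cast; ring
    rw [h1, h2, if_neg hk, periodize, hj, periodize_natCast ha (by omega),
      periodize_natCast ha (by omega), hint j (by omega), add_zero]

/-! ### The Green function of the cylinder -/

lemma sum_neighborFinset_p {n : ℕ} (hn : 2 ≤ n) (i : ZMod n)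
    [Fintype ((hexCylinder n).neighborSet (.p i))] (F : HexVertex n → ℝ) :
    ∑ y ∈ (hexCylinder n).neighborFinset (.p i), F y = F (.u i) + F (.u (i - 1)) + F (.q i) := by
  classical
  have : Fact (1 < n) := ⟨hn⟩
  have : (hexCylinder n).neighborFinset (.p i) = {.u i, .u (i - 1), .q i} := by
    ext ⟨t, j⟩
    rw [SimpleGraph.mem_neighborFinset]
    fin_cases t <;>
      simp [hexCylinder, HexVertex.p, HexVertex.u, HexVertex.q, HexVertex.v, eq_sub_iff_add_eq,
        eq_comm]
  have hi : i ≠ i - 1 := fun h => one_ne_zero (sub_eq_self.1 h.symm)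
  rw [this, Finset.sum_insert (by simp [HexVertex.u, HexVertex.q, hi]),
    Finset.sum_insert (by simp [HexVertex.u, HexVertex.q]), Finset.sum_singleton, add_assoc]

lemma sum_neighborFinset_q {n : ℕ} (hn : 2 ≤ n) (i : ZMod n)
    [Fintype ((hexCylinder n).neighborSet (.q i))] (F : HexVertex n → ℝ) :
    ∑ y ∈ (hexCylinder n).neighborFinset (.q i), F y = F (.v i) + F (.v (i - 1)) + F (.p i) := by
  classical
  have : Fact (1 < n) := ⟨hn⟩
  have : (hexCylinder n).neighborFinset (.q i) = {.v i, .v (i - 1), .p i} := by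
    ext ⟨t, j⟩
    rw [SimpleGraph.mem_neighborFinset]
    fin_cases t <;>
      simp [hexCylinder, HexVertex.p, HexVertex.u, HexVertex.q, HexVertex.v, eq_sub_iff_add_eq,
        eq_comm]
  have hi : i ≠ i - 1 := fun h => one_ne_zero (sub_eq_self.1 h.symm)
  rw [this, Finset.sum_insert (by simp [HexVertex.v, HexVertex.p, hi]),
    Finset.sum_insert (by simp [HexVertex.v, HexVertex.p]), Finset.sum_singleton, add_assoc]

lemma sum_neighborFinset_u {n : ℕ} (hn : 2 ≤ n) (i : ZMod n)
    [Fintype ((hexCylinder n).neighborSet (.u i))] (F : HexVertex n → ℝ) :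
    ∑ y ∈ (hexCylinder n).neighborFinset (.u i), F y = F (.p i) + F (.p (i + 1)) := by
  classical
  have : Fact (1 < n) := ⟨hn⟩
  have : (hexCylinder n).neighborFinset (.u i) = {.p (i + 1), .p i} := by
    ext ⟨t, j⟩
    rw [SimpleGraph.mem_neighborFinset]
    fin_cases t <;>
      simp [hexCylinder, HexVertex.p, HexVertex.u, HexVertex.q, HexVertex.v, eq_comm]
  rw [this, Finset.sum_pair (by simp [HexVertex.p]), add_comm]

lemma sum_neighborFinset_v {n : ℕ} (hn : 2 ≤ n) (i : ZMod n)
    [Fintype ((hexCylinder n).neighborSet (.v i))] (F : HexVertex n → ℝ) :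
    ∑ y ∈ (hexCylinder n).neighborFinset (.v i), F y = F (.q i) + F (.q (i + 1)) := by
  classical
  have : Fact (1 < n) := ⟨hn⟩
  have : (hexCylinder n).neighborFinset (.v i) = {.q (i + 1), .q i} := by
    ext ⟨t, j⟩
    rw [SimpleGraph.mem_neighborFinset]
    fin_cases t <;>
      simp [hexCylinder, HexVertex.p, HexVertex.u, HexVertex.q, HexVertex.v, eq_comm]
  rw [this, Finset.sum_pair (by simp [HexVertex.q]), add_comm]

/-- The extension to the cycle `p_0, u_0, p_1, u_1, …` of a translation-invariant kernel `g` on the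
vertices `p_i`. The two Boolean arguments tell whether the vertices are of type `u`, and `k` is the
difference of their indices. Between two vertices of type `u` the kernel is multiplied by `α`, and
in the mixed case it is the mean over the two neighbours of the vertex of type `u`, less `β`. -/
noncomputable def cycleKernel {n : ℕ} (g : ZMod n → ℝ) (α β : ℝ) : Bool → Bool → ZMod n → ℝ
  | false, false, k => g k
  | true, true, k => α * g k
  | false, true, k => (g k + g (k - 1)) / 2 - β
  | true, false, k => (g k + g (k + 1)) / 2 - β

/-- Whether a vertex is one of the `u_i`, `v_i`. -/
def isMiddle : Fin 4 → Bool := ![false, true, false, true]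

/-- The sign of the side of the cylinder: `1` for `p_i`, `u_i` and `-1` for `q_i`, `v_i`. -/
noncomputable def side : Fin 4 → ℝ := ![1, 1, -1, -1]

/-- The Green function of `R_n` built from a kernel `h` for the symmetric part and a kernel `A` for
the antisymmetric part. -/
noncomputable def green {n : ℕ} (h A : ZMod n → ℝ) (x y : HexVertex n) : ℝ :=
  (cycleKernel h 1 (1 / (4 * n)) (isMiddle x.1) (isMiddle y.1) (x.2 - y.2) +
    side x.1 * side y.1 * cycleKernel A 2 0 (isMiddle x.1) (isMiddle y.1) (x.2 - y.2)) / 2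

lemma green_comm {n : ℕ} {h A : ZMod n → ℝ} (hh : ∀ k, h (-k) = h k) (hA : ∀ k, A (-k) = A k)
    (x y : HexVertex n) : green h A x y = green h A y x := by
  obtain ⟨s, i⟩ := x
  obtain ⟨t, j⟩ := y
  have e0 : j - i = -(i - j) := by ring
  have e1 : -(i - j) - 1 = -(i - j + 1) := by ring
  have e2 : -(i - j) + 1 = -(i - j - 1) := by ring
  fin_cases s <;> fin_cases t <;>
    simp [green, cycleKernel, isMiddle, side, e0, e1, e2, hh, hA, -neg_sub, -neg_add_rev]

open Classical in
/-- Up to the constant `1 / (4n)`, which cancels between source and sink, the Laplacian of the Green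
function is the identity. -/
lemma laplacian_green {n : ℕ} [NeZero n] (hn : 2 ≤ n) {h A : ZMod n → ℝ}
    (hh : ∀ k, 2 * h k - h (k - 1) - h (k + 1) = -(2 / n) + if k = 0 then 2 else 0)
    (hA : ∀ k, 6 * A k - A (k - 1) - A (k + 1) = 0 + if k = 0 then 2 else 0)
    (x y : HexVertex n) :
    ∑ z ∈ (hexCylinder n).neighborFinset x, (green h A x y - green h A z y) =
      (if x = y then 1 else 0) - 1 / (4 * n) := by
  obtain ⟨s, i⟩ := x
  obtain ⟨t, j⟩ := y
  have e1 : i + 1 - j = i - j + 1 := by ring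
  have e2 : i - 1 - j = i - j - 1 := by ring
  have hc : (1 : ℝ) / (4 * n) = 1 / 4 * (1 / n) := by
    rw [one_div_mul_one_div]
  have hc' : (2 : ℝ) / n = 2 * (1 / n) := by ring
  have h1 := hh (i - j)
  have h2 := hA (i - j)
  rw [hc'] at h1
  have hs : (s, i) = HexVertex.p i ∨ (s, i) = HexVertex.u i ∨ (s, i) = HexVertex.q i ∨
      (s, i) = HexVertex.v i := by
    fin_cases s <;> simp [HexVertex.p, HexVertex.u, HexVertex.q, HexVertex.v]
  rcases hs with hs | hs | hs | hs
  · rw [hs, sum_neighborFinset_p hn]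
    fin_cases t <;>
      simp [green, cycleKernel, isMiddle, side, HexVertex.p, HexVertex.u, HexVertex.q, e2, hc,
        ← sub_eq_zero (a := i), -one_div] at h1 h2 ⊢ <;>
      split_ifs at h1 h2 ⊢ <;> linarith
  · rw [hs, sum_neighborFinset_u hn]
    fin_cases t <;>
      simp [green, cycleKernel, isMiddle, side, HexVertex.p, HexVertex.u, e1, hc,
        ← sub_eq_zero (a := i), -one_div] at h1 h2 ⊢ <;>
      split_ifs at h1 h2 ⊢ <;> linarith
  · rw [hs, sum_neighborFinset_q hn]
    fin_cases t <;>
      simp [green, cycleKernel, isMiddle, side, HexVertex.p, HexVertex.v, HexVertex.q, e2, hc,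
        ← sub_eq_zero (a := i), -one_div] at h1 h2 ⊢ <;>
      split_ifs at h1 h2 ⊢ <;> linarith
  · rw [hs, sum_neighborFinset_v hn]
    fin_cases t <;>
      simp [green, cycleKernel, isMiddle, side, HexVertex.q, HexVertex.v, e1, hc,
        ← sub_eq_zero (a := i), -one_div] at h1 h2 ⊢ <;>
      split_ifs at h1 h2 ⊢ <;> linarith

lemma effectiveResistance_eq_green {n : ℕ} [NeZero n] (hn : 2 ≤ n) {h A : ZMod n → ℝ}
    (hh : ∀ k, 2 * h k - h (k - 1) - h (k + 1) = -(2 / n) + if k = 0 then 2 else 0)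
    (hA : ∀ k, 6 * A k - A (k - 1) - A (k + 1) = 0 + if k = 0 then 2 else 0)
    (hh' : ∀ k, h (-k) = h k) (hA' : ∀ k, A (-k) = A k) (x y : HexVertex n) :
    effectiveResistance (hexCylinder n) x y =
      green h A x x + green h A y y - 2 * green h A x y := by
  classical
  have hf : IsUnitCurrentPotential (hexCylinder n) x y fun z => green h A z x - green h A z y := by
    intro z
    have h1 := laplacian_green hn hh hA z x
    have h2 := laplacian_green hn hh hA z y
    simp only [Finset.sum_sub_distrib] at h1 h2 ⊢
    split_ifs at h1 h2 ⊢ <;> linarith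
  rw [effectiveResistance_eq (hexCylinder_connected n) hf, green_comm hh' hA' y x]
  ring

/-! ### The two kernels -/

/-- The values on `{0, …, n}` of the kernel of the symmetric part: minus half the resistance between
`p_i` and `p_{i + j}` in the cycle of length `2n`. -/
noncomputable def parabola (n j : ℕ) : ℝ := -(j * (n - j) / n)

/-- The root less than `1` of `μ ^ 2 + 1 = 6 * μ`. -/
noncomputable def decayRate : ℝ := 3 - 2 * √2

/-- The values on `{0, …, n}` of the kernel of the antisymmetric part: the periodic solution of
`6 A k - A (k - 1) - A (k + 1) = 2 δ`. -/
noncomputable def decay (n j : ℕ) : ℝ :=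
  (decayRate ^ j + decayRate ^ (n - j)) / (2 * √2 * (1 - decayRate ^ n))

lemma parabola_zero (n : ℕ) : parabola n 0 = 0 := by simp [parabola]

lemma parabola_sub {n j : ℕ} (hj : j ≤ n) : parabola n (n - j) = parabola n j := by
  rw [parabola, parabola, Nat.cast_sub hj]
  ring

lemma parabola_recurrence {n : ℕ} (hn : 2 ≤ n) (k : ZMod n) :
    2 * periodize n (parabola n) k - periodize n (parabola n) (k - 1) -
      periodize n (parabola n) (k + 1) = -(2 / n) + if k = 0 then 2 else 0 := by
  have : NeZero n := ⟨by omega⟩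
  have hn0 : (n : ℝ) ≠ 0 := by positivity
  refine periodize_recurrence (by simp [parabola]) hn (fun j _ => ?_) ?_ k
  · simp only [parabola]
    push_cast
    field_simp
    ring
  · simp only [parabola, Nat.cast_sub (show 1 ≤ n by omega)]
    push_cast
    field_simp
    ring

lemma parabola_le {n j : ℕ} (h1 : 1 ≤ j) (h2 : j + 1 ≤ n) :
    parabola n j ≤ -((n - 1) / n) := by
  have hn : (0 : ℝ) < n := by exact_mod_cast (by omega : 0 < n)
  have h1' : (1 : ℝ) ≤ j := by exact_mod_cast h1
  have h2' : (j : ℝ) + 1 ≤ n := by exact_mod_cast h2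
  rw [parabola, neg_le_neg_iff]
  gcongr
  nlinarith

lemma parabola_div_two_le_sq_sub_one (n : ℕ) [NeZero n] :
    parabola n (n / 2) ≤ -(n / 4 - 1 / (4 * n)) := by
  have hn : (0 : ℝ) < n := by exact_mod_cast Nat.pos_of_neZero n
  have h : (n : ℝ) = 2 * (n / 2 : ℕ) ∨ (n : ℝ) = 2 * (n / 2 : ℕ) + 1 := by
    rcases Nat.even_or_odd' n with ⟨m, hm | hm⟩
    · left; exact_mod_cast (by omega : n = 2 * (n / 2))
    · right; exact_mod_cast (by omega : n = 2 * (n / 2) + 1)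
  have e : (n : ℝ) / 4 - 1 / (4 * n) = ((n ^ 2 - 1) / 4) / n := by field_simp
  rw [parabola, neg_le_neg_iff, e]
  gcongr
  rcases h with h | h <;> nlinarith

lemma parabola_div_two_le (n j : ℕ) : parabola n (n / 2) ≤ parabola n j := by
  rw [parabola, parabola, neg_le_neg_iff]
  refine div_le_div_of_nonneg_right ?_ (Nat.cast_nonneg n)
  -- Both sides differ by `(m - j) (n - m - j)` with `m = n / 2`, and `n - 2 m` is `0` or `1`.
  have : (0 : ℤ) ≤ ((n / 2 : ℕ) - j) * (n - (n / 2 : ℕ) - j) := by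
    rcases le_or_gt j (n / 2) with h | h
    · exact mul_nonneg (by omega) (by omega)
    · exact mul_nonneg_of_nonpos_of_nonpos (by omega) (by omega)
  have : (0 : ℝ) ≤ ((n / 2 : ℕ) - j) * (n - (n / 2 : ℕ) - j) := by exact_mod_cast this
  nlinarith

lemma decayRate_sq : decayRate ^ 2 + 1 = 6 * decayRate := by
  have := Real.sq_sqrt (show (0 : ℝ) ≤ 2 by norm_num)
  rw [decayRate]
  nlinarith

lemma sqrt_two_eq : 2 * √2 = 3 - decayRate := by
  rw [decayRate]; ring

lemma decayRate_pos : 0 < decayRate := by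
  have := Real.sq_sqrt (show (0 : ℝ) ≤ 2 by norm_num)
  rw [decayRate]
  nlinarith [Real.sqrt_nonneg 2]

lemma decayRate_lt_one : decayRate < 1 := by
  have := Real.one_lt_sqrt_two
  rw [decayRate]
  linarith

lemma decay_denom_pos {n : ℕ} (hn : n ≠ 0) : 0 < 2 * √2 * (1 - decayRate ^ n) := by
  have := pow_lt_one₀ decayRate_pos.le decayRate_lt_one hn
  have : 0 < 1 - decayRate ^ n := by linarith
  positivity

lemma decay_nonneg (n j : ℕ) : 0 ≤ decay n j := by
  have h0 := decayRate_pos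
  have := pow_le_one₀ (n := n) h0.le decayRate_lt_one.le
  have : 0 ≤ 1 - decayRate ^ n := by linarith
  rw [decay]
  positivity

lemma decay_sub {n j : ℕ} (hj : j ≤ n) : decay n (n - j) = decay n j := by
  rw [decay, decay, Nat.sub_sub_self hj, add_comm]

lemma decay_rec {n j : ℕ} (hj : j + 2 ≤ n) :
    6 * decay n (j + 1) - decay n j - decay n (j + 2) = 0 := by
  obtain ⟨l, rfl⟩ := Nat.exists_eq_add_of_le hj
  have e0 : j + 2 + l - (j + 1) = l + 1 := by omega
  have e1 : j + 2 + l - j = l + 2 := by omega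
  have e2 : j + 2 + l - (j + 2) = l := by omega
  rw [decay, decay, decay, e0, e1, e2, ← mul_div_assoc, ← sub_div, ← sub_div, div_eq_zero_iff]
  left
  linear_combination -(decayRate ^ j + decayRate ^ l) * decayRate_sq

lemma decay_one {n : ℕ} (hn : 1 ≤ n) : decay n 1 = 3 * decay n 0 - 1 := by
  obtain ⟨l, rfl⟩ := Nat.exists_eq_add_of_le' hn
  have hd := (decay_denom_pos (show l + 1 ≠ 0 by omega)).ne'
  rw [decay, decay, eq_sub_iff_add_eq, ← mul_div_assoc, div_add_one hd]
  congr 1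
  rw [sqrt_two_eq]
  simp only [Nat.add_sub_cancel, Nat.sub_zero, pow_zero]
  linear_combination decayRate ^ l * decayRate_sq

lemma decay_recurrence {n : ℕ} (hn : 2 ≤ n) (k : ZMod n) :
    6 * periodize n (decay n) k - periodize n (decay n) (k - 1) -
      periodize n (decay n) (k + 1) = 0 + if k = 0 then 2 else 0 := by
  have : NeZero n := ⟨by omega⟩
  refine periodize_recurrence (by simpa using decay_sub (Nat.zero_le n)) hn
    (fun j hj => decay_rec hj) ?_ k
  rw [decay_sub (by omega), decay_one (by omega)]
  ring

lemma decay_le_decay_one {n j : ℕ} (h1 : 1 ≤ j) (h2 : j + 1 ≤ n) : decay n j ≤ decay n 1 := by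
  have h0 := decayRate_pos
  have hd := decay_denom_pos (show n ≠ 0 by omega)
  obtain ⟨a, rfl⟩ := Nat.exists_eq_add_of_le' h1
  obtain ⟨b, rfl⟩ := Nat.exists_eq_add_of_le h2
  have e1 : a + 1 + 1 + b - (a + 1) = b + 1 := by omega
  have e2 : a + 1 + 1 + b - 1 = a + b + 1 := by omega
  rw [decay, decay, e1, e2]
  refine div_le_div_of_nonneg_right ?_ hd.le
  have ha := pow_le_one₀ (n := a) h0.le decayRate_lt_one.le
  have hb := pow_le_one₀ (n := b) h0.le decayRate_lt_one.le
  have : 0 ≤ decayRate * ((1 - decayRate ^ a) * (1 - decayRate ^ b)) :=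
    mul_nonneg h0.le (mul_nonneg (by linarith) (by linarith))
  nlinarith [this, pow_add decayRate a b, pow_succ decayRate a, pow_succ decayRate b,
    pow_succ decayRate (a + b)]

lemma third_le_decay_zero {n : ℕ} (hn : 1 ≤ n) : 1 / 3 ≤ decay n 0 := by
  linarith [decay_one hn, decay_nonneg n 1]

lemma decay_zero_le {n : ℕ} (hn : 3 ≤ n) : decay n 0 ≤ 5 / 14 := by
  have h1 := decay_one (show 1 ≤ n by omega)
  have h2 := decay_rec (show 0 + 2 ≤ n by omega)
  have h3 := decay_le_decay_one (show 1 ≤ 2 by omega) (show 2 + 1 ≤ n by omega)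
  norm_num at h2
  linarith

/-- From `decay n (j - 1) - decay n j = decay n j - decay n (j + 1) + 4 * decay n j` the increments
shrink at least by the factor `5`, starting from `1 - 2 * decay n 0 ≤ 1 / 3`. -/
lemma decay_sub_decay_succ_le {n j : ℕ} (hj : j + 1 ≤ n) :
    decay n j - decay n (j + 1) ≤ 1 / 3 / 5 ^ j := by
  induction j with
  | zero =>
    have h1 := decay_one (show 1 ≤ n by omega)
    have h2 := third_le_decay_zero (show 1 ≤ n by omega)
    norm_num
    linarith
  | succ j ih =>
    have h1 := ih (by omega)
    have h2 := decay_rec (show j + 2 ≤ n by omega)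
    have h3 := decay_nonneg n (j + 2)
    rw [pow_succ, ← div_div, le_div_iff₀ (by norm_num)]
    linarith

lemma parabola_succ_add_decay_le {n j : ℕ} (hn : 3 ≤ n) (hj : 2 * (j + 1) ≤ n) :
    -parabola n j + 2 * decay n j ≤ -parabola n (j + 1) + 2 * decay n (j + 1) := by
  have hn' : (3 : ℝ) ≤ n := by exact_mod_cast hn
  have hj' : 2 * ((j : ℝ) + 1) ≤ n := by exact_mod_cast hj
  have hd := decay_sub_decay_succ_le (show j + 1 ≤ n by omega)
  have hp : -parabola n (j + 1) + parabola n j = 1 - (2 * j + 1) / n := by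
    have : (n : ℝ) ≠ 0 := by positivity
    simp only [parabola]
    push_cast
    field_simp
    ring
  suffices h : 2 * (1 / 3 / (5 : ℝ) ^ j) ≤ 1 - (2 * j + 1) / n by linarith
  rcases Nat.eq_zero_or_pos j with rfl | hpos
  · have : 1 / (n : ℝ) ≤ 1 / 3 := one_div_le_one_div_of_le (by norm_num) hn'
    norm_num at this ⊢
    linarith
  · have hb : 2 * (j : ℝ) + 2 ≤ 5 ^ j := by
      have h1 := one_add_mul_le_pow (show (-2 : ℝ) ≤ 4 by norm_num) j
      have h2 : (1 : ℝ) ≤ j := by exact_mod_cast hpos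
      norm_num at h1
      linarith
    have h1 : (2 * (j : ℝ) + 1) / n ≤ (2 * j + 1) / (2 * j + 2) := by gcongr; linarith
    have h2 : 1 - (2 * (j : ℝ) + 1) / (2 * j + 2) = 1 / (2 * j + 2) := by
      field_simp
      ring
    have h3 : 1 / (5 : ℝ) ^ j ≤ 1 / (2 * j + 2) := one_div_le_one_div_of_le (by positivity) hb
    have h4 : 2 * (1 / 3 / (5 : ℝ) ^ j) = 2 / 3 * (1 / 5 ^ j) := by ring
    have h5 : 0 < 1 / (5 : ℝ) ^ j := by positivity
    linarith

/-- Among pairs of type `u`, `v`, the resistance is largest at index difference `⌊n / 2⌋`. -/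
lemma parabola_add_decay_le {n j : ℕ} (hn : 3 ≤ n) (hj : j ≤ n) :
    -parabola n j + 2 * decay n j ≤ -parabola n (n / 2) + 2 * decay n (n / 2) := by
  have key : ∀ i ≤ n / 2,
      -parabola n i + 2 * decay n i ≤ -parabola n (n / 2) + 2 * decay n (n / 2) := by
    intro i hi
    induction hi using Nat.decreasingInduction with
    | self => exact le_rfl
    | of_succ i hi ih => exact (parabola_succ_add_decay_le hn (by omega)).trans ih
  rcases le_or_gt j (n / 2) with h | h
  · exact key j h
  · rw [← parabola_sub hj, ← decay_sub hj]
    exact key _ (by omega)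

/-! ### The extremal resistances -/

lemma periodize_parabola_le {n : ℕ} [NeZero n] {k : ZMod n} (hk : k ≠ 0) :
    periodize n (parabola n) k ≤ -((n - 1) / n) :=
  parabola_le (Nat.one_le_iff_ne_zero.2 (by rwa [Ne, ZMod.val_eq_zero])) (ZMod.val_lt k)

lemma periodize_decay_le {n : ℕ} [NeZero n] {k : ZMod n} (hk : k ≠ 0) :
    periodize n (decay n) k ≤ decay n 1 :=
  decay_le_decay_one (Nat.one_le_iff_ne_zero.2 (by rwa [Ne, ZMod.val_eq_zero])) (ZMod.val_lt k)

lemma periodize_decay_le_zero {n : ℕ} [NeZero n] (hn : 3 ≤ n) (k : ZMod n) :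
    periodize n (decay n) k ≤ decay n 0 := by
  rcases eq_or_ne k 0 with rfl | hk
  · rw [periodize_zero]
  · linarith [periodize_decay_le hk, decay_one (show 1 ≤ n by omega), decay_zero_le hn]

lemma periodize_parabola_nonpos {n : ℕ} [NeZero n] (k : ZMod n) :
    periodize n (parabola n) k ≤ 0 := by
  have : (k.val : ℝ) ≤ n := by exact_mod_cast (ZMod.val_lt k).le
  rw [periodize, parabola, neg_nonpos]
  exact div_nonneg (mul_nonneg (Nat.cast_nonneg _) (by linarith)) (Nat.cast_nonneg _)

/-- In the cycle of length `2n`, the resistance between a vertex of type `p` and one of type `u` is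
at most `n / 2`. -/
lemma periodize_parabola_add_sub_one {n : ℕ} [NeZero n] (hn : 2 ≤ n) (k : ZMod n) :
    -(n / 4) ≤ (periodize n (parabola n) k + periodize n (parabola n) (k - 1)) / 2 -
      1 / (4 * n) := by
  have h0 : parabola n n = parabola n 0 := by simp [parabola]
  have hn0 : (0 : ℝ) < n := by exact_mod_cast (by omega : 0 < n)
  -- With `n` instead of `0` as the representative of `k = 0`, both arguments lie in `{0, …, n}`.
  obtain ⟨j, hj, rfl⟩ : ∃ j : ℕ, j + 1 ≤ n ∧ k = ((j + 1 : ℕ) : ZMod n) := by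
    refine ⟨(k - 1).val, ZMod.val_lt _, ?_⟩
    rw [Nat.cast_add, ZMod.natCast_zmod_val]
    simp
  have e : ((j + 1 : ℕ) : ZMod n) - 1 = (j : ZMod n) := by push_cast; ring
  rw [e, periodize_natCast h0 hj, periodize_natCast h0 (by omega)]
  have : (parabola n (j + 1) + parabola n j) / 2 - 1 / (4 * n) + n / 4 =
      (n - (2 * j + 1)) ^ 2 / (4 * n) := by
    simp only [parabola]
    push_cast
    field_simp
    ring
  have h2 : (0 : ℝ) ≤ (n - (2 * j + 1)) ^ 2 / (4 * n) := by positivity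
  linarith

/-- Bounds for the resistances between a vertex of type `p` or `q` and one of type `u` or `v`; the
difference of the `A`-terms occurs on the same side, their sum on opposite sides. -/
lemma mixed_bounds {n : ℕ} [NeZero n] (hn : 3 ≤ n) (k : ZMod n) :
    2 * decay n 0 ≤
        1 / (4 * n) - (periodize n (parabola n) k + periodize n (parabola n) (k - 1)) / 2 +
          3 * decay n 0 / 2 - (periodize n (decay n) k + periodize n (decay n) (k - 1)) / 2 ∧
      1 / (4 * n) - (periodize n (parabola n) k + periodize n (parabola n) (k - 1)) / 2 +
          3 * decay n 0 / 2 + (periodize n (decay n) k + periodize n (decay n) (k - 1)) / 2 ≤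
        n / 4 - 1 / (4 * n) + 2 * decay n 0 := by
  have : Fact (1 < n) := ⟨by omega⟩
  have hn' : (3 : ℝ) ≤ n := by exact_mod_cast hn
  have hc : 1 / (4 * (n : ℝ)) ≤ 1 / 12 := one_div_le_one_div_of_le (by norm_num) (by linarith)
  have hc' : ((n : ℝ) - 1) / n = 1 - 4 * (1 / (4 * n)) := by field_simp
  have a1 := decay_one (show 1 ≤ n by omega)
  have a2 := decay_zero_le hn
  have a3 := periodize_decay_le_zero hn k
  have a4 := periodize_decay_le_zero hn (k - 1)
  have p1 := periodize_parabola_add_sub_one (show 2 ≤ n by omega) k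
  have p2 := periodize_parabola_nonpos k
  have p3 := periodize_parabola_nonpos (k - 1)
  rcases eq_or_ne k 0 with hk | hk
  · have e : k - 1 ≠ 0 := by simp [hk]
    have b1 := periodize_decay_le e
    have b2 : periodize n (parabola n) (k - 1) = -((n - 1) / n) := by
      rw [hk, zero_sub, periodize_neg (fun _ => parabola_sub), periodize, ZMod.val_one, parabola]
      simp
    have z1 : periodize n (parabola n) k = 0 := by rw [hk, periodize_zero, parabola_zero]
    have z2 : periodize n (decay n) k = decay n 0 := by rw [hk, periodize_zero]
    constructor <;> linarith
  · have b1 := periodize_decay_le hk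
    have b2 := periodize_parabola_le hk
    refine ⟨by linarith, ?_⟩
    rcases eq_or_ne (k - 1) 0 with hk1 | hk1
    · have b3 : periodize n (parabola n) k = -((n - 1) / n) := by
        rw [sub_eq_zero.1 hk1, periodize, ZMod.val_one, parabola]
        simp
      have z1 : periodize n (parabola n) (k - 1) = 0 := by
        rw [hk1, periodize_zero, parabola_zero]
      have z2 : periodize n (decay n) (k - 1) = decay n 0 := by rw [hk1, periodize_zero]
      linarith
    · have b3 := periodize_decay_le hk1
      linarith

theorem theorem4p5 (n : ℕ) [NeZero n] (hn : 3 ≤ n) (a b : HexVertex n) :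
    effectiveResistance (hexCylinder n) a b ≤
        effectiveResistance (hexCylinder n) (HexVertex.u 1)
          (HexVertex.v (((n + 2) / 2 : ℕ) : ZMod n)) ∧
      (a ≠ b →
        effectiveResistance (hexCylinder n) (HexVertex.p 1) (HexVertex.q 1) ≤
          effectiveResistance (hexCylinder n) a b) := by
  have hn2 : 2 ≤ n := by omega
  have hn' : (3 : ℝ) ≤ n := by exact_mod_cast hn
  have hhe : ∀ k, periodize n (parabola n) (-k) = periodize n (parabola n) k :=
    periodize_neg fun _ => parabola_sub
  have hAe : ∀ k, periodize n (decay n) (-k) = periodize n (decay n) k :=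
    periodize_neg fun _ => decay_sub
  have R := effectiveResistance_eq_green hn2 (parabola_recurrence hn2) (decay_recurrence hn2)
    hhe hAe
  have hmin : effectiveResistance (hexCylinder n) (.p 1) (.q 1) = 2 * decay n 0 := by
    rw [R]
    simp [green, cycleKernel, isMiddle, side, HexVertex.p, HexVertex.q, periodize_zero,
      parabola_zero]
    ring
  have hmax : effectiveResistance (hexCylinder n) (.u 1) (.v (((n + 2) / 2 : ℕ) : ZMod n)) =
      -parabola n (n / 2) + 2 * decay n 0 + 2 * decay n (n / 2) := by
    have hm : (((n + 2) / 2 : ℕ) : ZMod n) = 1 + ((n / 2 : ℕ) : ZMod n) := by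
      rw [show (n + 2) / 2 = 1 + n / 2 by omega, Nat.cast_add, Nat.cast_one]
    have e1 : periodize n (parabola n) ((n / 2 : ℕ) : ZMod n) = parabola n (n / 2) :=
      periodize_natCast (by simp [parabola]) (Nat.div_le_self n 2)
    have e2 : periodize n (decay n) ((n / 2 : ℕ) : ZMod n) = decay n (n / 2) :=
      periodize_natCast (by simpa using decay_sub (Nat.zero_le n)) (Nat.div_le_self n 2)
    rw [R, hm]
    simp [green, cycleKernel, isMiddle, side, HexVertex.u, HexVertex.v, periodize_zero,
      parabola_zero, hhe, hAe, e1, e2]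
    ring
  rw [hmin, hmax, R]
  obtain ⟨s, i⟩ := a
  obtain ⟨t, j⟩ := b
  have a0 := third_le_decay_zero (show 1 ≤ n by omega)
  have a1 := decay_one (show 1 ≤ n by omega)
  have a2 := decay_zero_le hn
  have hc : 1 / (4 * (n : ℝ)) ≤ 1 / 12 := one_div_le_one_div_of_le (by norm_num) (by linarith)
  have hc' : ((n : ℝ) - 1) / n = 1 - 4 * (1 / (4 * n)) := by field_simp
  have m0 := decay_nonneg n (n / 2)
  have m1 := parabola_div_two_le_sq_sub_one n
  have m2 : parabola n (n / 2) ≤ periodize n (parabola n) (i - j) := parabola_div_two_le n _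
  have m3 : -periodize n (parabola n) (i - j) + 2 * periodize n (decay n) (i - j) ≤ _ :=
    parabola_add_decay_le hn (ZMod.val_lt (i - j)).le
  have k0 : 0 ≤ periodize n (decay n) (i - j) := decay_nonneg n _
  have k1 : 0 ≤ periodize n (decay n) (i - j - 1) := decay_nonneg n _
  have k2 : 0 ≤ periodize n (decay n) (i - j + 1) := decay_nonneg n _
  have k3 := periodize_decay_le_zero hn (i - j)
  have x1 := mixed_bounds hn (i - j)
  have x2 := mixed_bounds hn (i - j + 1)
  rw [add_sub_cancel_right] at x2
  obtain ⟨x1, x1'⟩ := x1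
  obtain ⟨x2, x2'⟩ := x2
  refine ⟨?_, fun hab => ?_⟩
  · fin_cases s <;> fin_cases t <;>
      simp [green, cycleKernel, isMiddle, side, periodize_zero, parabola_zero, -one_div] <;>
      linarith
  · rcases eq_or_ne (i - j) 0 with hk | hk
    · have hst : s ≠ t := by
        rintro rfl
        exact hab (by rw [sub_eq_zero.1 hk])
      have z1 : periodize n (parabola n) (i - j) = 0 := by rw [hk, periodize_zero, parabola_zero]
      have z2 : periodize n (decay n) (i - j) = decay n 0 := by rw [hk, periodize_zero]
      fin_cases s <;> fin_cases t <;> first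
        | exact absurd rfl hst
        | simp [green, cycleKernel, isMiddle, side, periodize_zero, parabola_zero, -one_div]
          linarith
    · have b1 := periodize_decay_le hk
      have b2 := periodize_parabola_le hk
      fin_cases s <;> fin_cases t <;>
        simp [green, cycleKernel, isMiddle, side, periodize_zero, parabola_zero, -one_div] <;>
        linarith
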